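/- Let $(\Omega,\mathcal F,\mathbb P)$ be a probability space, $d, M\in\mathbb N$, $\sigma\in\mathbb R$, $\epsilon\in(0,\tfrac12)$ and $\beta\in(0,1]$. Call a real random variable $y$ sub-Gaussian with variance proxy $\sigma^2$ if $\mathbb E[y]=0$ and $\mathbb E[\exp(\lambda y)]\le\exp(\sigma^2\lambda^2/2)$ for all $\lambda\in\mathbb R$, and call a random vector $\xi\in\mathbb R^d$ sub-Gaussian with variance proxy $\sigma^2$ if $z^\top\xi$ is so for every $z\in\mathbb R^d$ with $\|z\|_2=1$. Let $w\in\mathbb R^d$ be a square integrable random vector with mean $\mathbb E[w]=\mu$ and covariance $\mathbb E[(w-\mu)(w-\mu)^\top]=\Sigma\succ0$, and suppose that $\xi=\Sigma^{-1/2}(w-\mu)$ is sub-Gaussian with variance proxy $\sigma^2$. Let $w_0,\dots,w_{M-1}$ be independent copies of $w$, and let $$\hat\mu=\frac1M\sum_{i=0}^{M-1}w_i,\qquad \hat\Sigma=\frac1M\sum_{i=0}^{M-1}(w_i-\hat\mu)(w_i-\hat\mu)^\top .$$ For $\beta'>0$ put $$q(\beta',\epsilon,d)=d\log(1+1/\epsilon)+\log(2/\beta'),\qquad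 p(\beta',d)=d+2\sqrt{d\log(1/\beta')}+2\log(1/\beta'),$$ $$t_\Sigma(\beta')=\frac{\sigma^2}{1-2\epsilon}\left(\sqrt{\frac{32\,q(\beta',\epsilon,d)}{M}}+\frac{2\,q(\beta',\epsilon,d)}{M}\right),\qquad t_\mu(\beta')=\frac{\sigma^2}{M}\,p(\beta',d).$$ Write $q=q(\beta/2,\epsilon,d)$ and $p=p(\beta/2,d)$, and suppose that $$M>\left(\frac{\sigma^2\sqrt{32q}+\sqrt{32\sigma^4q+8\sigma^2(1-2\epsilon)q+4\sigma^2(1-2\epsilon)^2p}}{2(1-2\epsilon)}\right)^2 .$$ Then $1-t_\mu(\beta/2)-t_\Sigma(\beta/2)>0$, and with probability at least $1-\beta$ the matrix $\hat\Sigma$ is positive definite and $$(\hat\mu-\mu)^\top\hat\Sigma^{-1}(\hat\mu-\mu)\le r_\mu,\qquad \Sigma\preceq r_\Sigma\hat\Sigma,$$ where $$r_\Sigma=\frac{1}{1-t_\mu(\beta/2)-t_\Sigma(\beta/2)},\qquad r_\mu=\frac{t_\mu(\beta/2)}{1-t_\mu(\beta/2)-t_\Sigma(\beta/2)} .$$ 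-/

import Mathlib

open MeasureTheory ProbabilityTheory
open scoped MatrixOrder Matrix

noncomputable section

namespace AmbiguitySet

variable {Ω : Type*} [MeasurableSpace Ω]

/-- A real random variable `y` is sub-Gaussian with variance proxy `σ²`: it has mean zero and
`E[exp (t y)] ≤ exp (σ² t² / 2)` for all real `t`. (Mathlib's `HasSubgaussianMGF` contains the
integrability of all the `exp (t y)`, hence that of `y`.) -/
def IsSubGaussian (P : Measure Ω) (y : Ω → ℝ) (σ : ℝ) : Prop :=
  ∫ ω, y ω ∂P = 0 ∧ HasSubgaussianMGF y ⟨σ ^ 2, sq_nonneg σ⟩ P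

/-- A random vector `ξ` in `ℝ^d` is sub-Gaussian with variance proxy `σ²`: so is `zᵀ ξ` for every
`z` of Euclidean norm one. -/
def IsSubGaussianVec {d : ℕ} (P : Measure Ω) (ξ : Ω → Fin d → ℝ) (σ : ℝ) : Prop :=
  ∀ z : EuclideanSpace ℝ (Fin d), ‖z‖ = 1 → IsSubGaussian P (fun ω => z.ofLp ⬝ᵥ ξ ω) σ

/-- The inverse square root `S^{-1/2}` of a positive definite matrix `S`: the inverse of its
positive semidefinite square root. -/
def invSqrt {d : ℕ} (S : Matrix (Fin d) (Fin d) ℝ) : Matrix (Fin d) (Fin d) ℝ :=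
  (CFC.sqrt S)⁻¹

/-- The empirical mean `(1/M) ∑ x_i`. -/
def empMean {d M : ℕ} (x : Fin M → Fin d → ℝ) : Fin d → ℝ :=
  (1 / (M : ℝ)) • ∑ i, x i

/-- The empirical covariance `(1/M) ∑ (x_i - μ̂) (x_i - μ̂)ᵀ`. -/
def empCov {d M : ℕ} (x : Fin M → Fin d → ℝ) : Matrix (Fin d) (Fin d) ℝ :=
  (1 / (M : ℝ)) • ∑ i, Matrix.vecMulVec (x i - empMean x) (x i - empMean x)

/-- `q(β, ε, d) = d log (1 + 1/ε) + log (2/β)`. -/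
def q (β ε : ℝ) (d : ℕ) : ℝ :=
  d * Real.log (1 + 1 / ε) + Real.log (2 / β)

/-- `p(β, d) = d + 2 √(d log (1/β)) + 2 log (1/β)`. -/
def p (β : ℝ) (d : ℕ) : ℝ :=
  d + 2 * √(d * Real.log (1 / β)) + 2 * Real.log (1 / β)

/-- The radius of the isotropic covariance bound,
`t_Σ(β) = σ² / (1 - 2ε) * (√(32 q(β, ε, d) / M) + 2 q(β, ε, d) / M)`. -/
def tCov (σ ε : ℝ) (d M : ℕ) (β : ℝ) : ℝ :=
  σ ^ 2 / (1 - 2 * ε) * (√(32 * q β ε d / M) + 2 * q β ε d / M)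

/-- The radius of the isotropic mean bound, `t_μ(β) = (σ² / M) p(β, d)`. -/
def tMean (σ : ℝ) (d M : ℕ) (β : ℝ) : ℝ :=
  σ ^ 2 / M * p β d

/-- The sample size that has to be exceeded. -/
def sampleBound (σ ε : ℝ) (d : ℕ) (β : ℝ) : ℝ :=
  ((σ ^ 2 * √(32 * q (β / 2) ε d)
      + √(32 * σ ^ 4 * q (β / 2) ε d + 8 * σ ^ 2 * (1 - 2 * ε) * q (β / 2) ε d
          + 4 * σ ^ 2 * (1 - 2 * ε) ^ 2 * p (β / 2) d))
    / (2 * (1 - 2 * ε))) ^ 2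

/-- `r_Σ = 1 / (1 - t_μ(β/2) - t_Σ(β/2))`. -/
def rCov (σ ε : ℝ) (d M : ℕ) (β : ℝ) : ℝ :=
  1 / (1 - tMean σ d M (β / 2) - tCov σ ε d M (β / 2))

/-- `r_μ = t_μ(β/2) / (1 - t_μ(β/2) - t_Σ(β/2))`. -/
def rMean (σ ε : ℝ) (d M : ℕ) (β : ℝ) : ℝ :=
  tMean σ d M (β / 2) / (1 - tMean σ d M (β / 2) - tCov σ ε d M (β / 2))

end AmbiguitySet

end

/-! Write `w_i = μ + S^{1/2} ξ_i`. The empirical mean and covariance are equivariant under this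
affine map, so everything reduces to the isotropic samples `ξ_i` (`bounds_of_standardized`). If
their mean has squared norm at most `t_μ` and their empirical second moment is at least `1 - t_Σ` in
every unit direction, then their empirical covariance, being the second moment minus the square of
the mean, is at least `1 - t_μ - t_Σ` by Cauchy–Schwarz. Conjugation by `S^{1/2}` turns this into
all three assertions.

Each of the two bounds fails with probability at most `β/2`. For the mean, averaging the moment
generating function against a Gaussian weight bounds `E exp (η ‖X‖²)`, and Markov's inequality gives
the tail (`measureReal_sq_norm_ge_le`). For the second moment, centred squares are sub-exponential
(`mgf_sq_sub_one_le`), which gives a Chernoff bound in one direction; a union bound over a net of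
the sphere makes it uniform. A net argument losing `1 - 2δ` would be too weak for the term `log (1 +
1/ε)`; `abs_inner_le_of_net` loses only `1 - 2δ²`, and `exists_net_radius` converts this into the
stated constants. -/

namespace AmbiguitySet

/-! ### Nets of the sphere and quadratic forms. -/

section Net

variable {E : Type*} [NormedAddCommGroup E] [InnerProductSpace ℝ E] [FiniteDimensional ℝ E]

/-- Volume bound for separated subsets of the unit sphere. -/
theorem card_le_of_separated_sphere {δ : ℝ} (hδ : 0 < δ) (s : Finset E) (hs : ∀ x ∈ s, ‖x‖ = 1)
    (h : ∀ x ∈ s, ∀ y ∈ s, x ≠ y → δ ≤ ‖x - y‖) :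
    (s.card : ℝ) ≤ (1 + 2 / δ) ^ Module.finrank ℝ E := by
  borelize E
  let ν : Measure E := Measure.addHaar
  have hδ2 : 0 < δ / 2 := half_pos hδ
  have hρ : 0 < 1 + δ / 2 := by positivity
  have hdisj : Set.Pairwise (s : Set E)
      (Function.onFun Disjoint fun c => Metric.ball (c : E) (δ / 2)) := by
    rintro c hc e he hce
    apply Metric.ball_disjoint_ball
    rw [dist_eq_norm]
    linarith [h c hc e he hce]
  have hsub : (⋃ c ∈ s, Metric.ball (c : E) (δ / 2)) ⊆ Metric.ball 0 (1 + δ / 2) := by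
    refine Set.iUnion₂_subset fun x hx => Metric.ball_subset_ball' ?_
    rw [dist_zero_right, hs x hx, add_comm]
  have hvol : (s.card : ENNReal) * ENNReal.ofReal ((δ / 2) ^ Module.finrank ℝ E) *
        ν (Metric.ball 0 1) ≤
      ENNReal.ofReal ((1 + δ / 2) ^ Module.finrank ℝ E) * ν (Metric.ball 0 1) :=
    calc _ = ν (⋃ c ∈ s, Metric.ball (c : E) (δ / 2)) := by
          rw [measure_biUnion_finset hdisj fun c _ => measurableSet_ball]
          simp only [ν.addHaar_ball_of_pos _ hδ2, Finset.sum_const, nsmul_eq_mul, mul_assoc]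
      _ ≤ ν (Metric.ball (0 : E) (1 + δ / 2)) := measure_mono hsub
      _ = _ := by rw [ν.addHaar_ball_of_pos _ hρ]
  have hcard := (ENNReal.mul_le_mul_iff_left
    (Metric.measure_ball_pos ν (0 : E) zero_lt_one).ne' measure_ball_lt_top.ne).1 hvol
  have hreal := ENNReal.toReal_le_of_le_ofReal (by positivity) hcard
  rw [ENNReal.toReal_mul, ENNReal.toReal_natCast, ENNReal.toReal_ofReal (by positivity),
    ← le_div_iff₀ (by positivity), ← div_pow] at hreal
  have hdiv : (1 + δ / 2) / (δ / 2) = 1 + 2 / δ := by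
    field_simp
    ring
  rwa [hdiv] at hreal

/-- The unit sphere has a `δ`-net of at most `(1 + 2 / δ) ^ d` points. -/
theorem exists_sphere_net {δ : ℝ} (hδ : 0 < δ) :
    ∃ N : Finset E, (∀ y ∈ N, ‖y‖ = 1) ∧ (∀ z : E, ‖z‖ = 1 → ∃ y ∈ N, ‖z - y‖ ≤ δ) ∧
      (N.card : ℝ) ≤ (1 + 2 / δ) ^ Module.finrank ℝ E := by
  classical
  let C : Set ℕ := {n | ∃ s : Finset E, s.card = n ∧ (∀ x ∈ s, ‖x‖ = 1) ∧
    ∀ x ∈ s, ∀ y ∈ s, x ≠ y → δ ≤ ‖x - y‖}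
  have hne : C.Nonempty := ⟨0, ∅, by simp⟩
  have hbdd : BddAbove C := by
    refine ⟨⌈(1 + 2 / δ) ^ Module.finrank ℝ E⌉₊, ?_⟩
    rintro n ⟨s, rfl, h1, h2⟩
    exact_mod_cast (card_le_of_separated_sphere hδ s h1 h2).trans (Nat.le_ceil _)
  -- A separated set of largest size is a net: a point farther than `δ` from it could be added.
  obtain ⟨N, hN, h1, h2⟩ := Nat.sSup_mem hne hbdd
  refine ⟨N, h1, fun z hz => ?_, card_le_of_separated_sphere hδ N h1 h2⟩
  by_contra! hfar
  have hzN : z ∉ N := fun hzN => by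
    have := hfar z hzN
    simp at this
    linarith
  have hmem : N.card + 1 ∈ C := by
    refine ⟨insert z N, Finset.card_insert_of_notMem hzN, ?_, ?_⟩
    · simpa using ⟨hz, h1⟩
    · intro x hx y hy hxy
      rw [Finset.mem_insert] at hx hy
      rcases hx with rfl | hx <;> rcases hy with rfl | hy
      · exact absurd rfl hxy
      · exact (hfar y hy).le
      · rw [norm_sub_rev]; exact (hfar x hx).le
      · exact h2 x hx y hy hxy
  have := le_csSup hbdd hmem
  omega

/-- A symmetric operator whose quadratic form is bounded on a `δ`-net of the sphere. The loss is
only quadratic in `δ` because the form is stationary at its extremal points. -/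
theorem abs_inner_le_of_net {T : E →ₗ[ℝ] E} (hT : T.IsSymmetric) {δ s : ℝ} (hδ : 2 * δ ^ 2 < 1)
    {N : Finset E} (hN1 : ∀ y ∈ N, ‖y‖ = 1) (hN : ∀ z : E, ‖z‖ = 1 → ∃ y ∈ N, ‖z - y‖ ≤ δ)
    (hs : ∀ y ∈ N, |inner ℝ (T y) y| ≤ (1 - 2 * δ ^ 2) * s) {z : E} (hz : ‖z‖ = 1) :
    |inner ℝ (T z) z| ≤ s := by
  have hTc : Continuous T := T.continuous_of_finiteDimensional
  obtain ⟨x, hx, hmax⟩ := (isCompact_sphere (0 : E) 1).exists_isMaxOn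
    ⟨z, by simpa using hz⟩ (f := fun v => |inner ℝ (T v) v|)
    (Continuous.continuousOn (by fun_prop))
  rw [mem_sphere_zero_iff_norm] at hx
  set m : ℝ := |inner ℝ (T x) x| with hm
  have hm0 : 0 ≤ m := abs_nonneg _
  have hbound : ∀ v : E, |inner ℝ (T v) v| ≤ m * ‖v‖ ^ 2 := by
    intro v
    rcases eq_or_ne v 0 with rfl | hv
    · simp
    have hv' : ‖v‖ ≠ 0 := norm_ne_zero_iff.mpr hv
    have h1 : |inner ℝ (T (‖v‖⁻¹ • v)) (‖v‖⁻¹ • v)| ≤ m :=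
      hmax (show ‖v‖⁻¹ • v ∈ Metric.sphere (0 : E) 1 by simp [norm_smul, hv'])
    rw [map_smul, real_inner_smul_left, real_inner_smul_right, ← mul_assoc, abs_mul,
      abs_of_nonneg (by positivity)] at h1
    calc |inner ℝ (T v) v| = (‖v‖⁻¹ * ‖v‖⁻¹ * |inner ℝ (T v) v|) * ‖v‖ ^ 2 := by field_simp
      _ ≤ m * ‖v‖ ^ 2 := by gcongr
  refine (hmax (show z ∈ Metric.sphere (0 : E) 1 by simpa using hz)).trans ?_
  change m ≤ s
  obtain ⟨y, hy, hxy⟩ := hN x hx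
  obtain ⟨r, hr, hrm⟩ : ∃ r : ℝ, |r| = 1 ∧ r * inner ℝ (T x) x = m := by
    rcases abs_cases (inner ℝ (T x) x : ℝ) with h | h
    · exact ⟨1, by simp, by rw [hm, h.1, one_mul]⟩
    · exact ⟨-1, by simp, by rw [hm, h.1]; ring⟩
  have hrb : ∀ v : E, |r * inner ℝ (T v) v| ≤ m * ‖v‖ ^ 2 := fun v => by
    rw [abs_mul, hr, one_mul]; exact hbound v
  have hexp : ∀ (v : E) (t : ℝ), r * inner ℝ (T (x + t • v)) (x + t • v) =
      m + 2 * t * (r * inner ℝ (T x) v) + t ^ 2 * (r * inner ℝ (T v) v) := fun v t => by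
    have : inner ℝ (T v) x = inner ℝ (T x) v := by rw [hT, real_inner_comm]
    rw [← hrm]
    simp only [map_add, map_smul, inner_add_left, inner_add_right, real_inner_smul_left,
      real_inner_smul_right, this]
    ring
  have hnexp : ∀ (v : E) (t : ℝ), ‖x + t • v‖ ^ 2 = 1 + 2 * t * inner ℝ x v + t ^ 2 * ‖v‖ ^ 2 :=
    fun v t => by
      rw [norm_add_sq_real, hx, real_inner_smul_right, norm_smul, mul_pow, Real.norm_eq_abs, sq_abs]
      ring
  -- The maximizer `x` is an eigenvector of `r T`: `m ‖x + t v‖² - r ⟪T(x + t v), x + t v⟫` is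
  -- nonnegative and vanishes at `t = 0`, so its linear coefficient is zero.
  have hstat : ∀ v : E, r * inner ℝ (T x) v = m * inner ℝ x v := fun v => by
    have hq : ∀ t : ℝ, 0 ≤ (m * ‖v‖ ^ 2 - r * inner ℝ (T v) v) * (t * t) +
        (2 * (m * inner ℝ x v - r * inner ℝ (T x) v)) * t + 0 := fun t => by
      have h1 := (abs_le.1 (hrb (x + t • v))).2
      rw [hexp, hnexp] at h1
      linarith
    have hd := discrim_le_zero hq
    rw [discrim] at hd
    have : (m * inner ℝ x v - r * inner ℝ (T x) v) ^ 2 = 0 :=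
      le_antisymm (by linarith) (sq_nonneg _)
    linarith [pow_eq_zero_iff (two_ne_zero) |>.1 this]
  -- Since `‖x‖ = ‖y‖ = 1`, one has `2 ⟪x, y - x⟫ = -‖y - x‖²`. Hence the first-order term costs `m
  -- δ²` at most, and so does the second-order term.
  have hyx : y = x + (1 : ℝ) • (y - x) := by simp
  have e1 := hexp (y - x) 1
  have e2 := hnexp (y - x) 1
  rw [← hyx] at e1 e2
  rw [hN1 y hy] at e2
  rw [hstat] at e1
  have hd : ‖y - x‖ ^ 2 ≤ δ ^ 2 := by
    rw [norm_sub_rev]; gcongr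
  have h3 := (abs_le.1 (hrb (y - x))).1
  have h4 : r * inner ℝ (T y) y ≤ (1 - 2 * δ ^ 2) * s := by
    refine (le_abs_self _).trans ?_
    rw [abs_mul, hr, one_mul]; exact hs y hy
  have h5 : (1 - 2 * δ ^ 2) * m ≤ (1 - 2 * δ ^ 2) * s := by
    nlinarith [mul_le_mul_of_nonneg_left hd hm0]
  exact le_of_mul_le_mul_left h5 (by linarith)

end Net

/-- The radius of the net used for a given `ε`. -/
theorem exists_net_radius {ε : ℝ} (hε0 : 0 < ε) (hε : ε < 1 / 2) :
    ∃ δ : ℝ, 0 < δ ∧ 2 * δ ^ 2 < 1 ∧ 1 - 2 * ε ≤ 1 - 2 * δ ^ 2 ∧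
      Real.log (1 + 2 / δ) ≤ ((1 - 2 * δ ^ 2) / (1 - 2 * ε)) ^ 2 * Real.log (1 + 1 / ε) := by
  have h2 : 0 < 1 - 2 * ε := by linarith
  have hlog : 0 ≤ Real.log (1 + 1 / ε) := Real.log_nonneg (by simp [hε0.le])
  -- Radius `2ε` gives `1 + 2/δ = 1 + 1/ε`, and its loss `1 - 8ε²` is at least `1 - 2ε` exactly for
  -- `ε ≤ 1/4`. Beyond that the radius stays at `1/2`, and the factor `1/c²` pays for the larger
  -- net.
  rcases le_or_gt ε (1 / 4) with h | h
  · refine ⟨2 * ε, by positivity, by nlinarith, by nlinarith, ?_⟩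
    have : 1 + 2 / (2 * ε) = 1 + 1 / ε := by field_simp
    rw [this]
    refine le_mul_of_one_le_left hlog (one_le_pow₀ ?_)
    rw [one_le_div h2]
    nlinarith
  · refine ⟨1 / 2, by norm_num, by norm_num, by linarith, ?_⟩
    set c : ℝ := 2 * (1 - 2 * ε) with hc
    have hc0 : 0 < c := by positivity
    have hc1 : c ≤ 1 := by rw [hc]; linarith
    have hε' : ε = (2 - c) / 4 := by rw [hc]; ring
    -- Bernoulli's inequality for an exponent in `[0, 1]`; then `4c ≤ 4/(2 - c) = 1/ε` amounts to
    -- `(c - 1)² ≥ 0`.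
    have hb : (5 : ℝ) ^ c ≤ 1 + 4 * c := by
      have := rpow_one_add_le_one_add_mul_self (s := 4) (by norm_num) hc0.le hc1
      norm_num at this
      linarith
    have hb2 : 1 + 4 * c ≤ 1 + 1 / ε := by
      rw [hε', one_div_div, add_le_add_iff_left, le_div_iff₀ (by linarith)]
      nlinarith [sq_nonneg (c - 1)]
    have hl : c * Real.log 5 ≤ Real.log (1 + 1 / ε) := by
      rw [← Real.log_rpow (by norm_num)]
      exact Real.log_le_log (by positivity) (hb.trans hb2)
    have hl5 : 0 ≤ Real.log 5 := Real.log_nonneg (by norm_num)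
    have e1 : (1 : ℝ) + 2 / (1 / 2) = 5 := by norm_num
    have e2 : (1 - 2 * (1 / 2 : ℝ) ^ 2) / (1 - 2 * ε) = 1 / c := by
      rw [hc]; field_simp; norm_num
    rw [e1, e2, div_pow, one_pow, one_div, inv_mul_eq_div, le_div_iff₀ (by positivity)]
    calc Real.log 5 * c ^ 2 = c * (c * Real.log 5) := by ring
      _ ≤ 1 * (c * Real.log 5) := by gcongr
      _ ≤ _ := by rw [one_mul]; exact hl

/-! ### Exponential moments and tails of the norm of a sub-Gaussian vector. -/

section GaussianSmoothing

variable {E : Type*} [NormedAddCommGroup E] [InnerProductSpace ℝ E] [FiniteDimensional ℝ E]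
  [MeasurableSpace E] [BorelSpace E]

theorem lintegral_exp_neg_mul_sq_norm {b : ℝ} (hb : 0 < b) :
    ∫⁻ v : E, ENNReal.ofReal (Real.exp (-b * ‖v‖ ^ 2)) =
      ENNReal.ofReal ((Real.pi / b) ^ (Module.finrank ℝ E / 2 : ℝ)) := by
  have hint := GaussianFourier.integral_rexp_neg_mul_sq_norm (V := E) hb
  rw [← hint, ofReal_integral_eq_lintegral_ofReal _ (ae_of_all _ fun v => (Real.exp_pos _).le)]
  -- Integrability: the integral of a non-integrable function is zero by convention, whereas the
  -- Gaussian value is positive.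
  by_contra h
  rw [integral_undef h] at hint
  have : 0 < (Real.pi / b) ^ (Module.finrank ℝ E / 2 : ℝ) := by positivity
  linarith

/-- Completing the square and translating. Read from right to left, it expresses `exp (‖x‖² / (4b))`
as a Gaussian average of the linear exponentials that a moment generating function controls. -/
theorem lintegral_exp_neg_mul_sq_norm_add_inner {b : ℝ} (hb : 0 < b) (x : E) :
    ∫⁻ v : E, ENNReal.ofReal (Real.exp (-b * ‖v‖ ^ 2)) * ENNReal.ofReal (Real.exp (inner ℝ v x)) =
      ENNReal.ofReal ((Real.pi / b) ^ (Module.finrank ℝ E / 2 : ℝ)) *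
        ENNReal.ofReal (Real.exp (‖x‖ ^ 2 / (4 * b))) := by
  have hsq : ∀ v : E,
      ENNReal.ofReal (Real.exp (-b * ‖v‖ ^ 2)) * ENNReal.ofReal (Real.exp (inner ℝ v x)) =
      ENNReal.ofReal (Real.exp (-b * ‖v - (1 / (2 * b)) • x‖ ^ 2)) *
        ENNReal.ofReal (Real.exp (‖x‖ ^ 2 / (4 * b))) := fun v => by
    rw [← ENNReal.ofReal_mul (Real.exp_pos _).le, ← ENNReal.ofReal_mul (Real.exp_pos _).le,
      ← Real.exp_add, ← Real.exp_add]
    congr 2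
    rw [norm_sub_sq_real, real_inner_smul_right, norm_smul, mul_pow, Real.norm_eq_abs, sq_abs]
    field_simp
    ring
  simp_rw [hsq]
  rw [lintegral_mul_const _ (by fun_prop),
    lintegral_sub_right_eq_self (fun v : E => ENNReal.ofReal (Real.exp (-b * ‖v‖ ^ 2))),
    lintegral_exp_neg_mul_sq_norm hb]

variable {Ω : Type*} [MeasurableSpace Ω] {P : Measure Ω} [IsProbabilityMeasure P]

/-- Exponential square integrability of a sub-Gaussian vector, by averaging its moment generating
function against a Gaussian weight. -/
theorem integral_exp_sq_norm_le {X : Ω → E} (hX : AEMeasurable X P) {s b : ℝ} (hs : 0 ≤ s)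
    (hb : s / 2 < b)
    (hint : ∀ v : E, Integrable (fun ω => Real.exp (inner ℝ v (X ω))) P)
    (hmgf : ∀ v : E, ∫ ω, Real.exp (inner ℝ v (X ω)) ∂P ≤ Real.exp (s * ‖v‖ ^ 2 / 2)) :
    Integrable (fun ω => Real.exp (‖X ω‖ ^ 2 / (4 * b))) P ∧
      ∫ ω, Real.exp (‖X ω‖ ^ 2 / (4 * b)) ∂P ≤
        (b / (b - s / 2)) ^ (Module.finrank ℝ E / 2 : ℝ) := by
  have hb0 : 0 < b := by linarith
  have hbs : 0 < b - s / 2 := by linarith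
  have hmeas : AEMeasurable (fun ω => ENNReal.ofReal (Real.exp (‖X ω‖ ^ 2 / (4 * b)))) P := by
    fun_prop
  set K : ℝ := (Real.pi / b) ^ (Module.finrank ℝ E / 2 : ℝ) with hK
  have hK0 : 0 < K := by positivity
  have hKr : (Real.pi / (b - s / 2)) ^ (Module.finrank ℝ E / 2 : ℝ) =
      K * (b / (b - s / 2)) ^ (Module.finrank ℝ E / 2 : ℝ) := by
    rw [hK, ← Real.mul_rpow (by positivity) (by positivity)]
    congr 1
    field_simp
  have hswap : ENNReal.ofReal K * ∫⁻ ω, ENNReal.ofReal (Real.exp (‖X ω‖ ^ 2 / (4 * b))) ∂P ≤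
      ENNReal.ofReal K * ENNReal.ofReal ((b / (b - s / 2)) ^ (Module.finrank ℝ E / 2 : ℝ)) := by
    rw [← lintegral_const_mul'' _ hmeas]
    simp_rw [hK, ← lintegral_exp_neg_mul_sq_norm_add_inner hb0]
    rw [lintegral_lintegral_swap]
    · rw [← hK, ← ENNReal.ofReal_mul hK0.le, ← hKr, ← lintegral_exp_neg_mul_sq_norm hbs]
      refine lintegral_mono fun v => ?_
      rw [lintegral_const_mul' _ _ ENNReal.ofReal_ne_top,
        ← ofReal_integral_eq_lintegral_ofReal (hint v) (ae_of_all _ fun _ => (Real.exp_pos _).le),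
        ← ENNReal.ofReal_mul (Real.exp_pos _).le]
      refine ENNReal.ofReal_le_ofReal ?_
      calc _ ≤ Real.exp (-b * ‖v‖ ^ 2) * Real.exp (s * ‖v‖ ^ 2 / 2) := by
            gcongr; exact hmgf v
        _ = _ := by rw [← Real.exp_add]; congr 1; ring
    · have h1 : AEMeasurable (fun z : Ω × E => X z.1) (P.prod volume) := hX.comp_fst
      have h2 : AEMeasurable (fun z : Ω × E => inner ℝ z.2 (X z.1)) (P.prod volume) :=
        measurable_snd.aemeasurable.inner h1
      exact (by fun_prop : AEMeasurable (fun z : Ω × E =>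
        ENNReal.ofReal (Real.exp (-b * ‖z.2‖ ^ 2)) *
          ENNReal.ofReal (Real.exp (inner ℝ z.2 (X z.1)))) (P.prod volume))
  have hle := (ENNReal.mul_le_mul_iff_right (ENNReal.ofReal_pos.2 hK0).ne'
    ENNReal.ofReal_ne_top).1 hswap
  have hI : Integrable (fun ω => Real.exp (‖X ω‖ ^ 2 / (4 * b))) P := by
    refine ⟨(by fun_prop : AEMeasurable _ P).aestronglyMeasurable, ?_⟩
    rw [hasFiniteIntegral_iff_ofReal (ae_of_all _ fun _ => (Real.exp_pos _).le)]
    exact hle.trans_lt ENNReal.ofReal_lt_top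
  refine ⟨hI, ?_⟩
  rw [← ofReal_integral_eq_lintegral_ofReal hI (ae_of_all _ fun _ => (Real.exp_pos _).le)] at hle
  exact (ENNReal.ofReal_le_ofReal_iff (by positivity)).1 hle

/-- The tail bound of Hsu, Kakade and Zhang for the norm of a sub-Gaussian vector. -/
theorem measureReal_sq_norm_ge_le {X : Ω → E} (hX : AEMeasurable X P) {s t : ℝ} (hs : 0 < s)
    (ht : 0 < t) (hd : 0 < Module.finrank ℝ E)
    (hint : ∀ v : E, Integrable (fun ω => Real.exp (inner ℝ v (X ω))) P)
    (hmgf : ∀ v : E, ∫ ω, Real.exp (inner ℝ v (X ω)) ∂P ≤ Real.exp (s * ‖v‖ ^ 2 / 2)) :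
    P.real {ω | s * (Module.finrank ℝ E + 2 * √(Module.finrank ℝ E * t) + 2 * t) ≤ ‖X ω‖ ^ 2} ≤
      Real.exp (-t) := by
  set n : ℝ := (Module.finrank ℝ E : ℝ) with hn
  have hn0 : 0 < n := by rw [hn]; exact_mod_cast hd
  set u : ℝ := √t with hu
  set v : ℝ := √n with hv
  have hu0 : 0 < u := Real.sqrt_pos.2 ht
  have hv0 : 0 < v := Real.sqrt_pos.2 hn0
  have hut : u ^ 2 = t := Real.sq_sqrt ht.le
  have hvn : v ^ 2 = n := Real.sq_sqrt hn0.le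
  have hsq : √(n * t) = v * u := Real.sqrt_mul hn0.le t
  -- Chosen so that `b / (b - s/2) = 1 + 2u/v` and the final exponent comes out as exactly `-t`.
  set b : ℝ := s * (v + 2 * u) / (4 * u) with hb
  have hbs : b - s / 2 = s * v / (4 * u) := by rw [hb]; field_simp; ring
  have hbs0 : s / 2 < b := by
    have : 0 < s * v / (4 * u) := by positivity
    linarith
  obtain ⟨hI, hle⟩ := integral_exp_sq_norm_le hX hs.le hbs0 hint hmgf
  set η : ℝ := 1 / (4 * b) with hη
  have hη' : η = u / (s * (v + 2 * u)) := by rw [hη, hb]; field_simp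
  have hη0 : 0 ≤ η := by rw [hη']; positivity
  have hcongr : (fun ω => Real.exp (‖X ω‖ ^ 2 / (4 * b))) =
      fun ω => Real.exp (η * ‖X ω‖ ^ 2) := by
    funext ω; rw [hη, one_div, inv_mul_eq_div]
  rw [hcongr] at hI hle
  have hratio : b / (b - s / 2) = 1 + 2 * u / v := by rw [hbs, hb]; field_simp
  rw [hratio] at hle
  refine (measure_ge_le_exp_mul_mgf _ hη0 hI).trans ?_
  have hy1 : 1 ≤ 1 + 2 * u / v := by
    have : 0 ≤ 2 * u / v := by positivity
    linarith
  have hy0 : 0 < 1 + 2 * u / v := by linarith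
  -- The right side is `sinh (log y)` at `y = 1 + 2u/v ≥ 1`, and `x ≤ sinh x` for `x ≥ 0`.
  have hlog : Real.log (1 + 2 * u / v) ≤
      ((1 + 2 * u / v) - (1 + 2 * u / v)⁻¹) / 2 := by
    rw [← Real.sinh_log hy0]
    exact Real.self_le_sinh_iff.2 (Real.log_nonneg hy1)
  calc _ ≤ Real.exp (-η * (s * (n + 2 * √(n * t) + 2 * t))) * (1 + 2 * u / v) ^ (n / 2 : ℝ) := by
        gcongr; exact hle
    _ = Real.exp (-η * (s * (n + 2 * √(n * t) + 2 * t)) + Real.log (1 + 2 * u / v) * (n / 2)) := by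
        rw [Real.rpow_def_of_pos hy0, ← Real.exp_add]
    _ ≤ Real.exp (-t) := by
        refine Real.exp_le_exp.2 ?_
        calc _ ≤ -η * (s * (n + 2 * √(n * t) + 2 * t)) +
              (((1 + 2 * u / v) - (1 + 2 * u / v)⁻¹) / 2) * (n / 2) := by gcongr
          _ = -t := by
            rw [hsq, hη', ← hut, ← hvn]
            field_simp
            ring

end GaussianSmoothing

/-! ### Squares of sub-Gaussian variables: moment generating function and Chernoff bound. -/

section Scalar

variable {Ω : Type*} [MeasurableSpace Ω] {P : Measure Ω} [IsProbabilityMeasure P]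

/-- Termwise in the power series, as `c ^ (n + 2) ≤ c ^ 2`. It transfers one exponential moment to
all smaller parameters with a quadratic gain. -/
theorem exp_sub_one_sub_le {c x : ℝ} (hx : 0 ≤ x) (hc : |c| ≤ 1) :
    Real.exp (c * x) - 1 - c * x ≤ c ^ 2 * (Real.exp x - 1 - x) := by
  have hsum : ∀ y : ℝ, HasSum (fun n : ℕ => y ^ (n + 2) / (n + 2).factorial)
      (Real.exp y - 1 - y) := fun y => by
    have h := NormedSpace.expSeries_div_hasSum_exp (𝔸 := ℝ) y
    rw [← Real.exp_eq_exp_ℝ] at h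
    have := (hasSum_nat_add_iff' 2).2 h
    simpa [Finset.sum_range_succ, sub_sub] using this
  refine hasSum_le (fun n => ?_) (hsum (c * x)) ((hsum x).mul_left (c ^ 2))
  rw [← mul_div_assoc]
  refine div_le_div_of_nonneg_right ?_ (by positivity)
  rw [mul_pow]
  refine mul_le_mul_of_nonneg_right ?_ (by positivity)
  calc c ^ (n + 2) ≤ |c ^ (n + 2)| := le_abs_self _
    _ = |c| ^ n * c ^ 2 := by rw [abs_pow, pow_add, sq_abs]
    _ ≤ 1 * c ^ 2 := by gcongr; exact pow_le_one₀ (abs_nonneg _) hc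
    _ = c ^ 2 := one_mul _

theorem one_add_sq_half_le_cosh (x : ℝ) : 1 + x ^ 2 / 2 ≤ Real.cosh x := by
  have h1 : Real.cosh x = 2 * Real.sinh |x / 2| ^ 2 + 1 := by
    rw [← Real.abs_sinh, sq_abs, show x = 2 * (x / 2) by ring, Real.cosh_two_mul, Real.cosh_sq]
    ring_nf
  have h2 : |x / 2| ^ 2 ≤ Real.sinh |x / 2| ^ 2 := by
    gcongr
    exact Real.self_le_sinh_iff.2 (abs_nonneg _)
  rw [sq_abs] at h2
  linarith

/-- The variance proxy bounds the second moment. -/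
theorem one_le_of_integral_sq_eq_one {y : Ω → ℝ} {c : NNReal} (hy : HasSubgaussianMGF y c P)
    (h1 : ∫ ω, y ω ^ 2 ∂P = 1) : (1 : ℝ) ≤ c := by
  have hsq : Integrable (fun ω => y ω ^ 2) P := (hy.memLp 2).integrable_sq
  have key : ∀ t : ℝ, 1 + t ^ 2 / 2 ≤ Real.exp (c * t ^ 2 / 2) := fun t => by
    have i1 := hy.integrable_exp_mul t
    have i2 := hy.integrable_exp_mul (-t)
    have m1 := hy.mgf_le t
    have m2 := hy.mgf_le (-t)
    rw [mgf] at m1 m2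
    have hm : ∫ ω, (2 + t ^ 2 * y ω ^ 2) ∂P ≤
        ∫ ω, (Real.exp (t * y ω) + Real.exp (-t * y ω)) ∂P := by
      refine integral_mono ((integrable_const _).add (hsq.const_mul _)) (i1.add i2) fun ω => ?_
      have h := one_add_sq_half_le_cosh (t * y ω)
      rw [Real.cosh_eq, mul_pow] at h
      rw [neg_mul]
      linarith
    rw [integral_add i1 i2, integral_add (integrable_const _) (hsq.const_mul _),
      integral_const_mul, h1] at hm
    simp only [integral_const, probReal_univ, smul_eq_mul] at hm
    rw [neg_sq] at m2
    linarith
  by_contra! hc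
  have hc0 : (0 : ℝ) ≤ c := c.2
  have k := key (√(1 - c))
  -- With `t² = 1 - c` and `x = c (1 - c) / 2`, the inequality `exp x * (1 - x) ≤ 1` would force `1
  -- + (1 - c)² (2 - c) / 4 ≤ 1`.
  rw [Real.sq_sqrt (by linarith)] at k
  have h2 := Real.add_one_le_exp (-(c * (1 - c) / 2 : ℝ))
  have h3 : Real.exp (c * (1 - c) / 2) * Real.exp (-(c * (1 - c) / 2 : ℝ)) = 1 := by
    rw [← Real.exp_add]; simp
  have h4 : 0 < -(c * (1 - c) / 2 : ℝ) + 1 := by nlinarith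
  have h5 : (1 + (1 - c) / 2 : ℝ) * (-(c * (1 - c) / 2 : ℝ) + 1) ≤ 1 :=
    (mul_le_mul k h2 h4.le (Real.exp_pos _).le).trans_eq h3
  nlinarith [mul_pos (by linarith : (0 : ℝ) < 1 - c) (by linarith : (0 : ℝ) < 1 - c),
    mul_nonneg hc0 (by linarith : (0 : ℝ) ≤ 1 - c)]

/-- The centred square of a sub-Gaussian variable is sub-exponential. -/
theorem mgf_sq_sub_one_le {y : Ω → ℝ} {c : NNReal} (hy : HasSubgaussianMGF y c P)
    (h1 : ∫ ω, y ω ^ 2 ∂P = 1) {κ : ℝ} (hκ : |κ| ≤ 1 / 4) :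
    Integrable (fun ω => Real.exp (κ * ((y ω ^ 2 - 1) / c))) P ∧
      mgf (fun ω => (y ω ^ 2 - 1) / c) P κ ≤ Real.exp (8 * κ ^ 2) := by
  have hc1 : (1 : ℝ) ≤ c := one_le_of_integral_sq_eq_one hy h1
  have hc0 : (0 : ℝ) < c := by linarith
  have hym : AEMeasurable y P := hy.aemeasurable
  have hsq : Integrable (fun ω => y ω ^ 2) P := (hy.memLp 2).integrable_sq
  -- Taking `b = c` yields `E exp (y² / (4c)) ≤ √2`, rounded up to `3/2` below.
  obtain ⟨hI, hle⟩ := integral_exp_sq_norm_le (E := ℝ) (P := P) (X := y) (s := c) (b := c) hym hc0.le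
    (by linarith) (fun v => by simpa [mul_comm] using hy.integrable_exp_mul v) (fun v => by
      have := hy.mgf_le v
      simpa [mgf, mul_comm] using this)
  have hnorm : ∀ ω, ‖y ω‖ ^ 2 / (4 * c) = 1 / 4 * (y ω ^ 2 / c) := fun ω => by
    rw [Real.norm_eq_abs, sq_abs]; field_simp
  simp_rw [hnorm] at hI hle
  have hroot : ∫ ω, Real.exp (1 / 4 * (y ω ^ 2 / c)) ∂P ≤ 3 / 2 := by
    refine hle.trans ?_
    have : (c : ℝ) / (c - c / 2) = 2 := by field_simp; norm_num
    rw [this]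
    simp only [Module.finrank_self, Nat.cast_one]
    rw [← Real.sqrt_eq_rpow, Real.sqrt_le_left (by norm_num)]
    norm_num
  have hIκ : Integrable (fun ω => Real.exp (κ * (y ω ^ 2 / c))) P := by
    refine hI.mono' (by fun_prop : AEMeasurable _ P).aestronglyMeasurable (ae_of_all _ fun ω => ?_)
    rw [Real.norm_eq_abs, Real.abs_exp]
    gcongr
    exact (abs_le.1 hκ).2
  have hfac : ∀ ω, Real.exp (κ * ((y ω ^ 2 - 1) / c)) =
      Real.exp (-(κ / c)) * Real.exp (κ * (y ω ^ 2 / c)) := fun ω => by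
    rw [← Real.exp_add]; congr 1; ring
  refine ⟨by simp_rw [hfac]; exact hIκ.const_mul _, ?_⟩
  have hY : Integrable (fun ω => y ω ^ 2 / c) P := hsq.div_const _
  have hYint : ∫ ω, y ω ^ 2 / c ∂P = 1 / c := by rw [integral_div, h1]
  -- `exp_sub_one_sub_le` with factor `4κ` at `y² / (4c)`. After integration, `16 κ² (3/2 - 1)`
  -- produces the constant `8 κ²`.
  have hpt : ∀ ω, Real.exp (κ * (y ω ^ 2 / c)) ≤
      (1 - (4 * κ) ^ 2) + (κ - 4 * κ ^ 2) * (y ω ^ 2 / c) +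
        (4 * κ) ^ 2 * Real.exp (1 / 4 * (y ω ^ 2 / c)) := fun ω => by
    have := exp_sub_one_sub_le (c := 4 * κ) (x := 1 / 4 * (y ω ^ 2 / c)) (by positivity)
      (by rw [abs_mul, abs_of_pos (by norm_num : (0 : ℝ) < 4)]; linarith)
    have e : 4 * κ * (1 / 4 * (y ω ^ 2 / c)) = κ * (y ω ^ 2 / c) := by ring
    rw [e] at this
    linarith
  have hmono := integral_mono hIκ
    (((integrable_const _).add (hY.const_mul _)).add (hI.const_mul _)) hpt
  rw [integral_add' ((integrable_const _).add (hY.const_mul _)) (hI.const_mul _),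
    integral_add' (integrable_const _) (hY.const_mul _), integral_const_mul, integral_const_mul,
    hYint] at hmono
  simp only [integral_const, probReal_univ, smul_eq_mul, one_mul] at hmono
  have hbound : ∫ ω, Real.exp (κ * (y ω ^ 2 / c)) ∂P ≤ Real.exp (κ / c + 8 * κ ^ 2) := by
    refine le_trans ?_ (Real.add_one_le_exp _)
    have h2 := mul_le_mul_of_nonneg_left hroot (sq_nonneg (4 * κ))
    have h3 : 0 ≤ 4 * κ ^ 2 * (1 / c) := by positivity
    have h4 : κ * (1 / c) = κ / c := by ring
    nlinarith
  rw [mgf]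
  simp_rw [hfac]
  rw [integral_const_mul]
  calc _ ≤ Real.exp (-(κ / c)) * Real.exp (κ / c + 8 * κ ^ 2) := by gcongr
    _ = _ := by rw [← Real.exp_add]; congr 1; ring

/-- Two-sided tail bound for the empirical second moment. -/
theorem measureReal_abs_empirical_sq_ge_le {M : ℕ} {y : Fin M → Ω → ℝ} {c : NNReal}
    (hM : 0 < M) (hind : iIndepFun y P) (hy : ∀ i, HasSubgaussianMGF (y i) c P)
    (h1 : ∀ i, ∫ ω, y i ω ^ 2 ∂P = 1) {τ : ℝ} (hτ0 : 0 ≤ τ) (hτ : τ ≤ 4) :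
    P.real {ω | c * τ ≤ |1 / (M : ℝ) * ∑ i, y i ω ^ 2 - 1|} ≤
      2 * Real.exp (-(M * τ ^ 2 / 32)) := by
  have hc0 : (0 : ℝ) < c := by
    linarith [one_le_of_integral_sq_eq_one (hy ⟨0, hM⟩) (h1 ⟨0, hM⟩)]
  have hM0 : (0 : ℝ) < M := by exact_mod_cast hM
  let Z : Fin M → Ω → ℝ := fun i ω => (y i ω ^ 2 - 1) / c
  have hZind : iIndepFun Z P :=
    hind.comp (fun _ x => (x ^ 2 - 1) / (c : ℝ)) fun _ => by fun_prop
  have hZm : ∀ i, AEMeasurable (Z i) P := fun i => by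
    have := (hy i).aemeasurable
    fun_prop
  have hmgf : ∀ κ : ℝ, |κ| ≤ 1 / 4 →
      Integrable (fun ω => Real.exp (κ * (∑ i, Z i) ω)) P ∧
        mgf (∑ i, Z i) P κ ≤ Real.exp (M * (8 * κ ^ 2)) := fun κ hκ => by
    have hprod := hZind.mgf_sum₀ (t := κ) hZm Finset.univ
    refine ⟨?_, ?_⟩
    -- A non-integrable exponential would make the moment generating function zero by convention,
    -- but it is a product of positive factors.
    · by_contra hni
      rw [mgf_undef hni] at hprod
      have : 0 < ∏ i, mgf (Z i) P κ := Finset.prod_pos fun i _ =>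
        mgf_pos (mgf_sq_sub_one_le (hy i) (h1 i) hκ).1
      linarith
    · rw [hprod]
      calc _ ≤ ∏ _i : Fin M, Real.exp (8 * κ ^ 2) :=
            Finset.prod_le_prod (fun i _ => mgf_nonneg) fun i _ =>
              (mgf_sq_sub_one_le (hy i) (h1 i) hκ).2
        _ = _ := by rw [Finset.prod_const, Finset.card_univ, Fintype.card_fin, ← Real.exp_nat_mul]
  -- `κ = τ/16` minimizes `8 κ² - κ τ`, with value `-τ²/32`; it is admissible because `τ ≤ 4`.
  have hκ : |τ / 16| ≤ 1 / 4 := by rw [abs_of_nonneg (by positivity)]; linarith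
  have hκ' : |-(τ / 16)| ≤ 1 / 4 := by rwa [abs_neg]
  have hup := (measure_ge_le_exp_mul_mgf (M * τ) (by positivity : 0 ≤ τ / 16) (hmgf _ hκ).1).trans
    (mul_le_mul_of_nonneg_left (hmgf _ hκ).2 (Real.exp_pos _).le)
  have hlo := (measure_le_le_exp_mul_mgf (-(M * τ)) (by linarith : -(τ / 16) ≤ 0)
    (hmgf _ hκ').1).trans (mul_le_mul_of_nonneg_left (hmgf _ hκ').2 (Real.exp_pos _).le)
  have e1 : -(τ / 16) * (M * τ) + M * (8 * (τ / 16) ^ 2) = -(M * τ ^ 2 / 32) := by ring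
  have e2 : - -(τ / 16) * -(M * τ) + M * (8 * (-(τ / 16)) ^ 2) = -(M * τ ^ 2 / 32) := by ring
  rw [← Real.exp_add, e1] at hup
  rw [← Real.exp_add, e2] at hlo
  have hsub : {ω | c * τ ≤ |1 / (M : ℝ) * ∑ i, y i ω ^ 2 - 1|} ⊆
      {ω | M * τ ≤ (∑ i, Z i) ω} ∪ {ω | (∑ i, Z i) ω ≤ -(M * τ)} := by
    intro ω hω
    have hZ : (∑ i, Z i) ω = M / c * (1 / (M : ℝ) * ∑ i, y i ω ^ 2 - 1) := by
      simp only [Finset.sum_apply, Z]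
      rw [← Finset.sum_div, Finset.sum_sub_distrib]
      simp only [Finset.sum_const, Finset.card_univ, Fintype.card_fin, nsmul_eq_mul, mul_one]
      field_simp
    have hcM : M * τ = M / c * (c * τ) := by field_simp
    simp only [Set.mem_union, Set.mem_ofPred_eq, hZ, hcM] at hω ⊢
    have hpos : (0 : ℝ) ≤ M / c := by positivity
    rcases le_abs.1 hω with h | h
    · exact Or.inl (mul_le_mul_of_nonneg_left h hpos)
    · refine Or.inr ?_
      rw [← mul_neg]
      exact mul_le_mul_of_nonneg_left (by linarith) hpos
  calc _ ≤ _ := measureReal_mono hsub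
    _ ≤ _ := measureReal_union_le _ _
    _ ≤ _ := by linarith

end Scalar

/-! ### Mean and second moment of isotropic samples. -/

section Isotropic

variable {E : Type*} [NormedAddCommGroup E] [InnerProductSpace ℝ E] [FiniteDimensional ℝ E]
  [MeasurableSpace E] [BorelSpace E]
variable {Ω : Type*} [MeasurableSpace Ω] {P : Measure Ω} [IsProbabilityMeasure P]

omit [FiniteDimensional ℝ E] [IsProbabilityMeasure P] in
theorem iIndepFun_inner {M : ℕ} {X : Fin M → Ω → E} (hind : iIndepFun X P) (v : E) :
    iIndepFun (fun i ω => (inner ℝ v (X i ω) : ℝ)) P :=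
  hind.comp (fun _ x => inner ℝ v x) fun _ => by fun_prop

/-- Tail bound for the empirical mean of independent sub-Gaussian vectors. -/
theorem measureReal_sq_norm_mean_ge_le {M : ℕ} {X : Fin M → Ω → E} {c : NNReal} (hM : 0 < M)
    (hc : 0 < c) (hd : 0 < Module.finrank ℝ E) (hX : ∀ i, AEMeasurable (X i) P)
    (hind : iIndepFun X P)
    (hsub : ∀ v : E, ‖v‖ = 1 → ∀ i, HasSubgaussianMGF (fun ω => inner ℝ v (X i ω)) c P)
    {t : ℝ} (ht : 0 < t) :
    P.real {ω | c / M * (Module.finrank ℝ E + 2 * √(Module.finrank ℝ E * t) + 2 * t) ≤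
      ‖(1 / (M : ℝ)) • ∑ i, X i ω‖ ^ 2} ≤ Real.exp (-t) := by
  have hM0 : (0 : ℝ) < M := by exact_mod_cast hM
  have : Nontrivial E := Module.finrank_pos_iff.1 hd
  -- The hypothesis covers unit directions only, so `v` is rescaled; for `v = 0` any unit vector
  -- serves. The factor `1/M` turns the proxy `M c` of the sum into `c/M`.
  have key : ∀ v : E, ∃ Y : Ω → ℝ, HasSubgaussianMGF Y (M * c) P ∧
      ∀ ω, inner ℝ v ((1 / (M : ℝ)) • ∑ i, X i ω) = ‖v‖ / M * Y ω := fun v => by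
    obtain ⟨u, hu, hv⟩ : ∃ u : E, ‖u‖ = 1 ∧ v = ‖v‖ • u := by
      rcases eq_or_ne v 0 with rfl | hv
      · obtain ⟨u, hu⟩ := exists_norm_eq E (zero_le_one' ℝ)
        exact ⟨u, hu, by simp⟩
      · have : ‖v‖ ≠ 0 := norm_ne_zero_iff.2 hv
        exact ⟨‖v‖⁻¹ • v, by simp [norm_smul, this], by rw [smul_smul, mul_inv_cancel₀ this, one_smul]⟩
    refine ⟨fun ω => ∑ i, inner ℝ u (X i ω), ?_, fun ω => ?_⟩
    · have := HasSubgaussianMGF.sum_of_iIndepFun (iIndepFun_inner hind u) (s := Finset.univ)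
        fun i _ => hsub u hu i
      simpa using this
    · conv_lhs => rw [hv]
      rw [real_inner_smul_left, real_inner_smul_right, inner_sum]
      ring
  refine measureReal_sq_norm_ge_le (by fun_prop) (by positivity) ht hd (fun v => ?_) (fun v => ?_)
  · obtain ⟨Y, hY, hv⟩ := key v
    simp_rw [hv]
    exact hY.integrable_exp_mul _
  · obtain ⟨Y, hY, hv⟩ := key v
    simp_rw [hv]
    refine (hY.mgf_le _).trans_eq ?_
    congr 1
    push_cast
    field_simp

/-- The operator `z ↦ (1/M) ∑ ⟪x i, z⟫ x i - z`. -/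
noncomputable def secondMomentDeviation {M : ℕ} (x : Fin M → E) : E →ₗ[ℝ] E :=
  (1 / (M : ℝ)) • ∑ i, (innerₗ E (x i)).smulRight (x i) - LinearMap.id

omit [FiniteDimensional ℝ E] [MeasurableSpace E] [BorelSpace E] in
theorem inner_secondMomentDeviation {M : ℕ} (x : Fin M → E) (y z : E) :
    inner ℝ (secondMomentDeviation x y) z =
      1 / (M : ℝ) * ∑ i, inner ℝ y (x i) * inner ℝ z (x i) - inner ℝ y z := by
  simp only [secondMomentDeviation, LinearMap.sub_apply, LinearMap.smul_apply, LinearMap.sum_apply,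
    LinearMap.smulRight_apply, innerₗ_apply_apply, LinearMap.id_apply, inner_sub_left, sum_inner,
    real_inner_smul_left]
  simp_rw [real_inner_comm y, real_inner_comm z]

/-- Uniform deviation of the empirical second moments of isotropic sub-Gaussian vectors. -/
theorem measureReal_secondMoment_le {M : ℕ} {X : Fin M → Ω → E} {c : NNReal} (hM : 0 < M)
    (hind : iIndepFun X P)
    (hsub : ∀ v : E, ‖v‖ = 1 → ∀ i, HasSubgaussianMGF (fun ω => inner ℝ v (X i ω)) c P)
    (hiso : ∀ v : E, ‖v‖ = 1 → ∀ i, ∫ ω, inner ℝ v (X i ω) ^ 2 ∂P = 1)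
    {δ τ s : ℝ} (hδ0 : 0 < δ) (hδ : 2 * δ ^ 2 < 1) (hτ0 : 0 ≤ τ) (hτ : τ ≤ 4)
    (hs : c * τ = (1 - 2 * δ ^ 2) * s) :
    P.real {ω | ¬ ∀ z : E, ‖z‖ = 1 → |1 / (M : ℝ) * ∑ i, inner ℝ z (X i ω) ^ 2 - 1| ≤ s} ≤
      (1 + 2 / δ) ^ Module.finrank ℝ E * (2 * Real.exp (-(M * τ ^ 2 / 32))) := by
  obtain ⟨N, hN1, hN, hcard⟩ := exists_sphere_net (E := E) hδ0
  have hform : ∀ ω (z : E), ‖z‖ = 1 →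
      inner ℝ (secondMomentDeviation (fun i => X i ω) z) z =
        1 / (M : ℝ) * ∑ i, inner ℝ z (X i ω) ^ 2 - 1 := fun ω z hz => by
    rw [inner_secondMomentDeviation, real_inner_self_eq_norm_sq, hz, one_pow]
    simp_rw [sq]
  have hsubset : {ω | ¬ ∀ z : E, ‖z‖ = 1 →
        |1 / (M : ℝ) * ∑ i, inner ℝ z (X i ω) ^ 2 - 1| ≤ s} ⊆
      ⋃ y ∈ N, {ω | c * τ ≤ |1 / (M : ℝ) * ∑ i, inner ℝ y (X i ω) ^ 2 - 1|} := by
    intro ω hω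
    by_contra hcon
    simp only [Set.mem_iUnion, Set.mem_ofPred_eq, not_exists, not_le] at hcon
    refine hω fun z hz => ?_
    rw [← hform ω z hz]
    refine abs_inner_le_of_net (fun y w => ?_) hδ hN1 hN (fun y hy => ?_) hz
    · rw [← real_inner_comm y, inner_secondMomentDeviation, inner_secondMomentDeviation,
        real_inner_comm w y]
      simp_rw [mul_comm]
    · rw [hform ω y (hN1 y hy), ← hs]
      exact (hcon y hy).le
  calc _ ≤ _ := measureReal_mono hsubset (measure_ne_top _ _)
    _ ≤ ∑ y ∈ N, _ := measureReal_biUnion_finset_le _ _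
    _ ≤ ∑ y ∈ N, 2 * Real.exp (-(M * τ ^ 2 / 32)) := Finset.sum_le_sum fun y hy =>
        measureReal_abs_empirical_sq_ge_le hM (iIndepFun_inner hind y) (hsub y (hN1 y hy))
          (hiso y (hN1 y hy)) hτ0 hτ
    _ = N.card * (2 * Real.exp (-(M * τ ^ 2 / 32))) := by rw [Finset.sum_const, nsmul_eq_mul]
    _ ≤ _ := by gcongr

end Isotropic

/-! ### The sample size condition and the failure probability of the net. -/

section Numeric

theorem q_pos {β ε : ℝ} (hε0 : 0 < ε) (hβ0 : 0 < β) (hβ1 : β ≤ 1) (d : ℕ) : 0 < q (β / 2) ε d := by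
  have h1 : 0 ≤ Real.log (1 + 1 / ε) := Real.log_nonneg (by simp [hε0.le])
  have h2 : 0 < Real.log (2 / (β / 2)) := Real.log_pos (by
    rw [one_lt_div (by positivity)]; linarith)
  unfold q
  positivity

theorem p_pos {β : ℝ} (hβ0 : 0 < β) (hβ1 : β ≤ 1) (d : ℕ) : 0 < p (β / 2) d := by
  have h2 : 0 < Real.log (1 / (β / 2)) := Real.log_pos (by
    rw [one_lt_div (by positivity)]; linarith)
  unfold p
  positivity

/-- The sample size condition says exactly that the radii add up to less than one. -/
theorem one_sub_tMean_sub_tCov_pos {σ ε β : ℝ} {d M : ℕ} (hε0 : 0 < ε) (hε : ε < 1 / 2)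
    (hβ0 : 0 < β) (hβ1 : β ≤ 1) (hM : sampleBound σ ε d β < M) :
    0 < 1 - tMean σ d M (β / 2) - tCov σ ε d M (β / 2) := by
  have hQ := q_pos hε0 hβ0 hβ1 d
  have hp := p_pos hβ0 hβ1 d
  unfold sampleBound at hM
  unfold tMean tCov
  set Q := q (β / 2) ε d
  set R := p (β / 2) d
  set e := 1 - 2 * ε with he
  have he0 : 0 < e := by linarith
  have hM0 : (0 : ℝ) < M := lt_of_le_of_lt (sq_nonneg _) hM
  set a := √(M : ℝ) with ha
  have ha0 : 0 < a := Real.sqrt_pos.2 hM0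
  have haM : a ^ 2 = M := Real.sq_sqrt hM0.le
  set D := 32 * σ ^ 4 * Q + 8 * σ ^ 2 * e * Q + 4 * σ ^ 2 * e ^ 2 * R with hD
  have hD0 : 0 ≤ D := by positivity
  set r := √(32 * Q) with hr
  have hrQ : r ^ 2 = 32 * Q := Real.sq_sqrt (by positivity)
  -- The left side is the larger root of the quadratic in `a = √M` appearing in `hquad`, and `D` is
  -- its discriminant.
  have hroot : (σ ^ 2 * r + √D) / (2 * e) < a := Real.lt_sqrt_of_sq_lt hM
  rw [div_lt_iff₀ (by positivity)] at hroot
  have hDsq : √D ^ 2 = D := Real.sq_sqrt hD0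
  have hlt : D < (2 * e * a - σ ^ 2 * r) ^ 2 := by
    rw [← hDsq]
    have := Real.sqrt_nonneg D
    gcongr
    linarith
  have hquad : 0 < e * a ^ 2 - σ ^ 2 * r * a - (2 * σ ^ 2 * Q + σ ^ 2 * e * R) := by
    have h4 : 0 < 4 * e * (e * a ^ 2 - σ ^ 2 * r * a - (2 * σ ^ 2 * Q + σ ^ 2 * e * R)) := by
      have : (2 * e * a - σ ^ 2 * r) ^ 2 =
          4 * e ^ 2 * a ^ 2 - 4 * e * a * σ ^ 2 * r + σ ^ 4 * (32 * Q) := by rw [← hrQ]; ring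
      rw [this, hD] at hlt
      linarith
    exact pos_of_mul_pos_right h4 (by positivity)
  have hsq : √(32 * Q / M) = r / a := Real.sqrt_div (by positivity) _
  rw [hsq, ← haM]
  have : 1 - σ ^ 2 / a ^ 2 * R - σ ^ 2 / e * (r / a + 2 * Q / a ^ 2) =
      (e * a ^ 2 - σ ^ 2 * r * a - (2 * σ ^ 2 * Q + σ ^ 2 * e * R)) / (e * a ^ 2) := by
    field_simp
    ring
  rw [this]
  positivity

/-- The covering number times the pointwise tail is at most `β / 2`. -/
theorem net_tail_le {σ ε β δ τ : ℝ} {d M : ℕ} (hε0 : 0 < ε) (hε : ε < 1 / 2) (hβ0 : 0 < β)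
    (hβ1 : β ≤ 1) (hM : 0 < M) (hσ : 0 < σ ^ 2) (hδ0 : 0 < δ)
    (hδε : 1 - 2 * ε ≤ 1 - 2 * δ ^ 2)
    (hlog : Real.log (1 + 2 / δ) ≤ ((1 - 2 * δ ^ 2) / (1 - 2 * ε)) ^ 2 * Real.log (1 + 1 / ε))
    (hτ : σ ^ 2 * τ = (1 - 2 * δ ^ 2) * tCov σ ε d M (β / 2)) :
    (1 + 2 / δ) ^ d * (2 * Real.exp (-(M * τ ^ 2 / 32))) ≤ β / 2 := by
  have hQ := q_pos hε0 hβ0 hβ1 d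
  have hM0 : (0 : ℝ) < M := by exact_mod_cast hM
  have he0 : 0 < 1 - 2 * ε := by linarith
  have hl : 0 < Real.log (2 / (β / 2)) := Real.log_pos (by
    rw [one_lt_div (by positivity)]; linarith)
  set k := (1 - 2 * δ ^ 2) / (1 - 2 * ε) with hk
  have hk1 : 1 ≤ k := (one_le_div he0).2 hδε
  have hτ' : τ = k * (√(32 * q (β / 2) ε d / M) + 2 * q (β / 2) ε d / M) := by
    apply mul_left_cancel₀ hσ.ne'
    rw [hτ, tCov, hk]
    ring
  have hτ2 : k ^ 2 * q (β / 2) ε d ≤ M * τ ^ 2 / 32 := by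
    -- The square-root term of the radius alone already gives the required exponent; `2q/M` is
    -- dropped.
    have h1 : k * √(32 * q (β / 2) ε d / M) ≤ τ := by
      rw [hτ']; gcongr; exact le_add_of_nonneg_right (by positivity)
    have h2 : k ^ 2 * (32 * q (β / 2) ε d / M) ≤ τ ^ 2 := by
      rw [← Real.sq_sqrt (by positivity : 0 ≤ 32 * q (β / 2) ε d / M), ← mul_pow]
      gcongr
    calc _ = M * (k ^ 2 * (32 * q (β / 2) ε d / M)) / 32 := by field_simp
      _ ≤ _ := by gcongr
  have hexpo : d * Real.log (1 + 2 / δ) + Real.log (2 / (β / 2)) ≤ M * τ ^ 2 / 32 := by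
    refine le_trans ?_ hτ2
    rw [q, mul_add]
    have h1 : (d : ℝ) * Real.log (1 + 2 / δ) ≤ d * (k ^ 2 * Real.log (1 + 1 / ε)) := by gcongr
    have h2 : Real.log (2 / (β / 2)) ≤ k ^ 2 * Real.log (2 / (β / 2)) :=
      le_mul_of_one_le_left hl.le (one_le_pow₀ hk1)
    linarith
  have hpos : 0 < 1 + 2 / δ := by positivity
  calc _ ≤ (1 + 2 / δ) ^ d *
        (2 * Real.exp (-(d * Real.log (1 + 2 / δ) + Real.log (2 / (β / 2))))) := by gcongr
    _ = β / 2 := by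
      rw [neg_add, Real.exp_add, ← Real.log_inv, Real.exp_log (by positivity), Real.exp_neg,
        Real.exp_nat_mul, Real.exp_log hpos]
      field_simp

end Numeric

/-! ### Deterministic reduction to standardized samples. -/

section Algebra

variable {d M : ℕ}

theorem empMean_affine (hM : 0 < M) (T : Matrix (Fin d) (Fin d) ℝ) (μ : Fin d → ℝ)
    (x : Fin M → Fin d → ℝ) :
    empMean (fun i => μ + T *ᵥ x i) = μ + T *ᵥ empMean x := by
  have hM0 : (M : ℝ) ≠ 0 := by exact_mod_cast hM.ne'
  simp only [empMean, Finset.sum_add_distrib, Finset.sum_const, Finset.card_univ, Fintype.card_fin,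
    smul_add, Matrix.mulVec_smul, Matrix.mulVec_sum]
  rw [← Nat.cast_smul_eq_nsmul ℝ, smul_smul, one_div, inv_mul_cancel₀ hM0, one_smul]

theorem empCov_affine (hM : 0 < M) {T : Matrix (Fin d) (Fin d) ℝ} (hT : Tᵀ = T) (μ : Fin d → ℝ)
    (x : Fin M → Fin d → ℝ) :
    empCov (fun i => μ + T *ᵥ x i) = T * empCov x * T := by
  have hterm : ∀ u : Fin d → ℝ, Matrix.vecMulVec (T *ᵥ u) (T *ᵥ u) = T * Matrix.vecMulVec u u * T :=
    fun u => by
      rw [Matrix.mul_vecMulVec, Matrix.vecMulVec_mul, ← Matrix.mulVec_transpose, hT]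
  simp only [empCov, empMean_affine hM, add_sub_add_left_eq_sub, ← Matrix.mulVec_sub, hterm]
  rw [Matrix.mul_smul, Matrix.smul_mul, Finset.mul_sum, Finset.sum_mul]

theorem isHermitian_empCov (x : Fin M → Fin d → ℝ) : (empCov x).IsHermitian := by
  rw [empCov, Matrix.IsHermitian, Matrix.conjTranspose_eq_transpose_of_trivial,
    Matrix.transpose_smul, Matrix.transpose_sum]
  simp_rw [Matrix.transpose_vecMulVec]

/-- The quadratic form of the empirical covariance is an empirical variance. -/
theorem dotProduct_empCov_mulVec (hM : 0 < M) (x : Fin M → Fin d → ℝ) (z : Fin d → ℝ) :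
    z ⬝ᵥ (empCov x *ᵥ z) = 1 / (M : ℝ) * ∑ i, (z ⬝ᵥ x i) ^ 2 - (z ⬝ᵥ empMean x) ^ 2 := by
  have hM0 : (M : ℝ) ≠ 0 := by exact_mod_cast hM.ne'
  have hmean : ∑ i, z ⬝ᵥ x i = M * (z ⬝ᵥ empMean x) := by
    rw [empMean, dotProduct_smul, dotProduct_sum, smul_eq_mul]
    field_simp
  rw [empCov, Matrix.smul_mulVec, dotProduct_smul, smul_eq_mul, Matrix.sum_mulVec, dotProduct_sum]
  have hterm : ∀ i, z ⬝ᵥ (Matrix.vecMulVec (x i - empMean x) (x i - empMean x) *ᵥ z) =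
      (z ⬝ᵥ x i) ^ 2 - 2 * (z ⬝ᵥ empMean x) * (z ⬝ᵥ x i) + (z ⬝ᵥ empMean x) ^ 2 := fun i => by
    rw [Matrix.vecMulVec_mulVec, dotProduct_comm (x i - empMean x) z]
    simp only [dotProduct_sub, dotProduct_smul, MulOpposite.smul_eq_mul_unop, MulOpposite.unop_op]
    ring
  simp_rw [hterm]
  rw [Finset.sum_add_distrib, Finset.sum_sub_distrib, ← Finset.mul_sum, hmean, Finset.sum_const,
    Finset.card_univ, Fintype.card_fin, nsmul_eq_mul]
  field_simp
  ring

theorem dotProduct_sq_le (u v : Fin d → ℝ) : (u ⬝ᵥ v) ^ 2 ≤ (u ⬝ᵥ u) * (v ⬝ᵥ v) := by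
  simpa [dotProduct, sq] using Finset.sum_mul_sq_le_sq_mul_sq Finset.univ u v

variable {T C : Matrix (Fin d) (Fin d) ℝ} {c : ℝ}

theorem posDef_of_le (hC : C.IsHermitian) (hc : 0 < c)
    (hle : ∀ z, c * (z ⬝ᵥ z) ≤ z ⬝ᵥ (C *ᵥ z)) : C.PosDef := by
  refine Matrix.PosDef.of_dotProduct_mulVec_pos hC fun z hz => ?_
  rw [star_trivial]
  refine lt_of_lt_of_le (mul_pos hc ?_) (hle z)
  simpa using Matrix.dotProduct_star_self_pos_iff.2 hz

theorem posDef_conj (hT : T.PosDef) (hC : C.PosDef) : (T * C * T).PosDef := by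
  have := hC.conjTranspose_mul_mul_same (B := T)
    (Matrix.mulVec_injective_of_isUnit hT.isUnit)
  rwa [hT.isHermitian.eq] at this

theorem posSemidef_smul_conj_sub (hT : T.PosDef) (hC : C.IsHermitian) (hc : 0 < c)
    (hle : ∀ z, c * (z ⬝ᵥ z) ≤ z ⬝ᵥ (C *ᵥ z)) :
    ((1 / c) • (T * C * T) - T * T).PosSemidef := by
  have h1 : ((1 / c) • C - 1).PosSemidef := by
    refine Matrix.PosSemidef.of_dotProduct_mulVec_nonneg
      ((hC.smul (IsSelfAdjoint.all _)).sub Matrix.isHermitian_one) fun z => ?_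
    rw [star_trivial, Matrix.sub_mulVec, Matrix.smul_mulVec, Matrix.one_mulVec, dotProduct_sub,
      dotProduct_smul, smul_eq_mul, sub_nonneg, one_div, inv_mul_eq_div, le_div_iff₀ hc, mul_comm]
    exact hle z
  have h2 := h1.conjTranspose_mul_mul_same T
  rw [hT.isHermitian.eq, Matrix.mul_sub, Matrix.sub_mul, Matrix.mul_one, Matrix.mul_smul,
    Matrix.smul_mul] at h2
  exact h2

/-- The left side is `x ⬝ᵥ v` for `v = C⁻¹ x`. The lower bound on `C` gives `c ‖v‖² ≤ x ⬝ᵥ v`, and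
Cauchy–Schwarz then gives `c (x ⬝ᵥ v) ≤ ‖x‖²`. -/
theorem dotProduct_inv_conj_le (hT : T.PosDef) (hC : C.PosDef) (hc : 0 < c)
    (hle : ∀ z, c * (z ⬝ᵥ z) ≤ z ⬝ᵥ (C *ᵥ z)) (x : Fin d → ℝ) :
    (T *ᵥ x) ⬝ᵥ ((T * C * T)⁻¹ *ᵥ (T *ᵥ x)) ≤ (x ⬝ᵥ x) / c := by
  have hTt : Tᵀ = T := by
    have := hT.isHermitian.eq
    rwa [Matrix.conjTranspose_eq_transpose_of_trivial] at this
  have hTdet : IsUnit T.det := (Matrix.isUnit_iff_isUnit_det T).1 hT.isUnit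
  have hCdet : IsUnit C.det := (Matrix.isUnit_iff_isUnit_det C).1 hC.isUnit
  set v := C⁻¹ *ᵥ x with hv
  have hCv : C *ᵥ v = x := by
    rw [hv, Matrix.mulVec_mulVec, Matrix.mul_nonsing_inv _ hCdet, Matrix.one_mulVec]
  have hquad : (T *ᵥ x) ⬝ᵥ ((T * C * T)⁻¹ *ᵥ (T *ᵥ x)) = x ⬝ᵥ v := by
    have e1 : (T * C * T)⁻¹ *ᵥ (T *ᵥ x) = T⁻¹ *ᵥ v := by
      rw [hv, Matrix.mulVec_mulVec, Matrix.mulVec_mulVec, Matrix.mul_inv_rev, Matrix.mul_inv_rev,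
        Matrix.mul_assoc, Matrix.mul_assoc, Matrix.nonsing_inv_mul _ hTdet, Matrix.mul_one]
    have e2 : (T *ᵥ x) ⬝ᵥ (T⁻¹ *ᵥ v) = x ⬝ᵥ (T *ᵥ (T⁻¹ *ᵥ v)) := by
      rw [Matrix.dotProduct_mulVec x T, ← Matrix.mulVec_transpose, hTt]
    rw [e1, e2, Matrix.mulVec_mulVec, Matrix.mul_nonsing_inv _ hTdet, Matrix.one_mulVec]
  have h1 := hle v
  rw [hCv, dotProduct_comm v x] at h1
  have h2 := dotProduct_sq_le x v
  have hxx : 0 ≤ x ⬝ᵥ x := by simpa using dotProduct_star_self_nonneg x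
  have hvv : 0 ≤ v ⬝ᵥ v := by simpa using dotProduct_star_self_nonneg v
  rw [hquad, le_div_iff₀ hc]
  rcases (le_trans (by positivity) h1 : 0 ≤ x ⬝ᵥ v).eq_or_lt with h0 | h0
  · rw [← h0, zero_mul]; exact hxx
  · refine le_of_mul_le_mul_right ?_ h0
    calc x ⬝ᵥ v * c * x ⬝ᵥ v = c * (x ⬝ᵥ v) ^ 2 := by ring
      _ ≤ c * ((x ⬝ᵥ x) * (v ⬝ᵥ v)) := by gcongr
      _ = (x ⬝ᵥ x) * (c * (v ⬝ᵥ v)) := by ring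
      _ ≤ (x ⬝ᵥ x) * (x ⬝ᵥ v) := by gcongr

/-- Bounds on the standardized sample give the bounds on the sample. -/
theorem bounds_of_standardized (hM : 0 < M) (hT : T.PosDef) (μ : Fin d → ℝ)
    (x : Fin M → Fin d → ℝ) {a b : ℝ} (hab : 0 < 1 - a - b)
    (hmean : empMean x ⬝ᵥ empMean x ≤ a)
    (hcov : ∀ z : Fin d → ℝ, (1 - b) * (z ⬝ᵥ z) ≤ 1 / (M : ℝ) * ∑ i, (z ⬝ᵥ x i) ^ 2) :
    (empCov fun i => μ + T *ᵥ x i).PosDef ∧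
      (empMean (fun i => μ + T *ᵥ x i) - μ) ⬝ᵥ
        ((empCov fun i => μ + T *ᵥ x i)⁻¹ *ᵥ (empMean (fun i => μ + T *ᵥ x i) - μ)) ≤
          a / (1 - a - b) ∧
      ((1 / (1 - a - b)) • (empCov fun i => μ + T *ᵥ x i) - T * T).PosSemidef := by
  have hTt : Tᵀ = T := by
    have := hT.isHermitian.eq
    rwa [Matrix.conjTranspose_eq_transpose_of_trivial] at this
  have hle : ∀ z, (1 - a - b) * (z ⬝ᵥ z) ≤ z ⬝ᵥ (empCov x *ᵥ z) := fun z => by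
    have hzz : 0 ≤ z ⬝ᵥ z := by simpa using dotProduct_star_self_nonneg z
    rw [dotProduct_empCov_mulVec hM]
    have h1 := dotProduct_sq_le z (empMean x)
    have h2 := mul_le_mul_of_nonneg_left hmean hzz
    linarith [hcov z]
  have hC := posDef_of_le (isHermitian_empCov x) hab hle
  rw [empMean_affine hM, empCov_affine hM hTt, add_sub_cancel_left]
  refine ⟨posDef_conj hT hC, ?_, posSemidef_smul_conj_sub hT (isHermitian_empCov x) hab hle⟩
  refine (dotProduct_inv_conj_le hT hC hab hle _).trans ?_
  gcongr

end Algebra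

/-! ### Whitening by the inverse square root. -/

section Standardization

variable {Ω : Type*} [MeasurableSpace Ω] {P : Measure Ω} [IsProbabilityMeasure P] {d : ℕ}

theorem posDef_sqrt {S : Matrix (Fin d) (Fin d) ℝ} (hS : S.PosDef) :
    (CFC.sqrt S).PosDef ∧ CFC.sqrt S * CFC.sqrt S = S := by
  have hmul : CFC.sqrt S * CFC.sqrt S = S := CFC.sqrt_mul_sqrt_self S hS.posSemidef.nonneg
  have hpsd : (CFC.sqrt S).PosSemidef := Matrix.nonneg_iff_posSemidef.1 (CFC.sqrt_nonneg S)
  refine ⟨hpsd.posDef_iff_isUnit.2 ?_, hmul⟩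
  exact isUnit_of_mul_isUnit_left (hmul.symm ▸ hS.isUnit)

/-- The standardized vector is isotropic. -/
theorem integral_sq_dotProduct_invSqrt {w : Ω → Fin d → ℝ} (hw : MemLp w 2 P) (μ : Fin d → ℝ)
    {S : Matrix (Fin d) (Fin d) ℝ}
    (hS : ∀ i j, ∫ ω, (w ω i - μ i) * (w ω j - μ j) ∂P = S i j) (hSpos : S.PosDef)
    (z : Fin d → ℝ) :
    ∫ ω, (z ⬝ᵥ (invSqrt S *ᵥ (w ω - μ))) ^ 2 ∂P = z ⬝ᵥ z := by
  obtain ⟨hT, hTT⟩ := posDef_sqrt hSpos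
  have hA : (invSqrt S)ᵀ = invSqrt S := by
    have := hT.inv.isHermitian.eq
    rwa [Matrix.conjTranspose_eq_transpose_of_trivial] at this
  have hdet : IsUnit (CFC.sqrt S).det := (Matrix.isUnit_iff_isUnit_det _).1 hT.isUnit
  have hASA : invSqrt S * (S * invSqrt S) = 1 := by
    rw [invSqrt]
    nth_rewrite 2 [← hTT]
    rw [Matrix.mul_assoc, Matrix.mul_nonsing_inv _ hdet, Matrix.mul_one,
      Matrix.nonsing_inv_mul _ hdet]
  set u := invSqrt S *ᵥ z with hu
  have hz : ∀ ω, z ⬝ᵥ (invSqrt S *ᵥ (w ω - μ)) = u ⬝ᵥ (w ω - μ) := fun ω => by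
    rw [Matrix.dotProduct_mulVec, ← Matrix.mulVec_transpose, hA]
  have hLp : ∀ i, MemLp (fun ω => w ω i - μ i) 2 P := fun i =>
    (memLp_pi_iff.1 hw i).sub (memLp_const _)
  have hint : ∀ i j, Integrable (fun ω => (w ω i - μ i) * (w ω j - μ j)) P := fun i j =>
    (hLp i).integrable_mul (hLp j)
  have hexp : ∀ ω, (u ⬝ᵥ (w ω - μ)) ^ 2 =
      ∑ i, ∑ j, u i * u j * ((w ω i - μ i) * (w ω j - μ j)) := fun ω => by
    rw [sq, dotProduct, Finset.sum_mul_sum]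
    refine Finset.sum_congr rfl fun i _ => Finset.sum_congr rfl fun j _ => ?_
    simp only [Pi.sub_apply]
    ring
  simp_rw [hz, hexp]
  rw [integral_finsetSum _ fun i _ => integrable_finsetSum _ fun j _ => (hint i j).const_mul _]
  simp_rw [integral_finsetSum Finset.univ fun j _ => (hint _ j).const_mul _, integral_const_mul, hS]
  have : ∑ i, ∑ j, u i * u j * S i j = u ⬝ᵥ (S *ᵥ u) := by
    simp only [dotProduct, Matrix.mulVec, Finset.mul_sum]
    refine Finset.sum_congr rfl fun i _ => Finset.sum_congr rfl fun j _ => ?_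
    ring
  have hadj : u ⬝ᵥ (S *ᵥ u) = z ⬝ᵥ (invSqrt S *ᵥ (S *ᵥ u)) := by
    rw [Matrix.dotProduct_mulVec z, ← Matrix.mulVec_transpose, hA]
  rw [this, hadj, hu, Matrix.mulVec_mulVec, Matrix.mulVec_mulVec, Matrix.mul_assoc, hASA,
    Matrix.one_mulVec]

end Standardization

end AmbiguitySet

/-! ### Assembly of the two failure events. -/

theorem mainTheorem2
    {Ω : Type*} [MeasurableSpace Ω] (P : Measure Ω) [IsProbabilityMeasure P]
    (d M : ℕ) (σ ε β : ℝ)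
    (hε0 : 0 < ε) (hε : ε < 1 / 2) (hβ0 : 0 < β) (hβ1 : β ≤ 1)
    -- the random vector `w`, square integrable, with mean `μ` and covariance `S ≻ 0`
    (w : Ω → Fin d → ℝ) (hw : MemLp w 2 P)
    (μ : Fin d → ℝ) (hμ : ∫ ω, w ω ∂P = μ)
    (S : Matrix (Fin d) (Fin d) ℝ)
    (hS : ∀ i j, ∫ ω, (w ω i - μ i) * (w ω j - μ j) ∂P = S i j)
    (hSpos : S.PosDef)
    (hsub : AmbiguitySet.IsSubGaussianVec P
      (fun ω => AmbiguitySet.invSqrt S *ᵥ (w ω - μ)) σ)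
    -- the samples: independent copies of `w`
    (W : Fin M → Ω → Fin d → ℝ)
    (hindep : iIndepFun W P) (hident : ∀ i, IdentDistrib (W i) w P P)
    (hM : AmbiguitySet.sampleBound σ ε d β < (M : ℝ)) :
    0 < 1 - AmbiguitySet.tMean σ d M (β / 2) - AmbiguitySet.tCov σ ε d M (β / 2) ∧
    1 - β ≤ P.real {ω |
      (AmbiguitySet.empCov (fun i => W i ω)).PosDef ∧
      (AmbiguitySet.empMean (fun i => W i ω) - μ) ⬝ᵥ
          ((AmbiguitySet.empCov (fun i => W i ω))⁻¹ *ᵥ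
            (AmbiguitySet.empMean (fun i => W i ω) - μ))
        ≤ AmbiguitySet.rMean σ ε d M β ∧
      (AmbiguitySet.rCov σ ε d M β • AmbiguitySet.empCov (fun i => W i ω) - S).PosSemidef} := by
  have hpos := AmbiguitySet.one_sub_tMean_sub_tCov_pos hε0 hε hβ0 hβ1 hM
  refine ⟨hpos, ?_⟩
  have hQ := AmbiguitySet.q_pos hε0 hβ0 hβ1 d
  have hp := AmbiguitySet.p_pos hβ0 hβ1 d
  have hMr : (0 : ℝ) < M := lt_of_le_of_lt (sq_nonneg _) hM
  have hM0 : 0 < M := by exact_mod_cast hMr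
  have he0 : 0 < 1 - 2 * ε := by linarith
  have htm : 0 ≤ AmbiguitySet.tMean σ d M (β / 2) := by unfold AmbiguitySet.tMean; positivity
  have htc : 0 ≤ AmbiguitySet.tCov σ ε d M (β / 2) := by unfold AmbiguitySet.tCov; positivity
  obtain ⟨hT, hTT⟩ := AmbiguitySet.posDef_sqrt hSpos
  have hdet : IsUnit (CFC.sqrt S).det := (Matrix.isUnit_iff_isUnit_det _).1 hT.isUnit
  -- the standardized samples
  let ξ : Fin M → Ω → Fin d → ℝ := fun i ω => AmbiguitySet.invSqrt S *ᵥ (W i ω - μ)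
  have hW : ∀ ω, (fun i => W i ω) = fun i => μ + CFC.sqrt S *ᵥ ξ i ω := fun ω => by
    funext i
    simp only [ξ, AmbiguitySet.invSqrt]
    rw [Matrix.mulVec_mulVec, Matrix.mul_nonsing_inv _ hdet, Matrix.one_mulVec, add_sub_cancel]
  set A : Set Ω := {ω | AmbiguitySet.tMean σ d M (β / 2) ≤
    AmbiguitySet.empMean (fun i => ξ i ω) ⬝ᵥ AmbiguitySet.empMean (fun i => ξ i ω)} with hA
  set B : Set Ω := {ω | ¬ ∀ z : EuclideanSpace ℝ (Fin d), ‖z‖ = 1 →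
    |1 / (M : ℝ) * ∑ i, (z.ofLp ⬝ᵥ ξ i ω) ^ 2 - 1| ≤ AmbiguitySet.tCov σ ε d M (β / 2)} with hB
  set G : Set Ω := {ω |
      (AmbiguitySet.empCov (fun i => W i ω)).PosDef ∧
      (AmbiguitySet.empMean (fun i => W i ω) - μ) ⬝ᵥ
          ((AmbiguitySet.empCov (fun i => W i ω))⁻¹ *ᵥ
            (AmbiguitySet.empMean (fun i => W i ω) - μ))
        ≤ AmbiguitySet.rMean σ ε d M β ∧
      (AmbiguitySet.rCov σ ε d M β • AmbiguitySet.empCov (fun i => W i ω) - S).PosSemidef} with hG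
  have hgood : ∀ ω, AmbiguitySet.empMean (fun i => ξ i ω) ⬝ᵥ
      AmbiguitySet.empMean (fun i => ξ i ω) ≤ AmbiguitySet.tMean σ d M (β / 2) →
      ω ∉ B → ω ∈ G := fun ω h1 h2 => by
    simp only [hB, Set.mem_ofPred_eq, not_not] at h2
    have := AmbiguitySet.bounds_of_standardized hM0 hT μ (fun i => ξ i ω) hpos h1 (fun z => by
      rcases eq_or_ne z 0 with rfl | hz
      · simp
      set n := ‖WithLp.toLp 2 z‖ with hn
      have hn0 : 0 < n := norm_pos_iff.2 (by simpa using hz)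
      have hnz : n ^ 2 = z ⬝ᵥ z := by
        rw [hn, EuclideanSpace.real_norm_sq_eq, dotProduct]
        simp_rw [sq]
      have h3 := (abs_le.1 (h2 (n⁻¹ • WithLp.toLp 2 z) (by
        rw [norm_smul, norm_inv, norm_norm, inv_mul_cancel₀ hn0.ne']))).1
      simp only [WithLp.ofLp_smul, smul_dotProduct, smul_eq_mul, mul_pow, ← Finset.mul_sum] at h3
      rw [← hnz]
      calc (1 - AmbiguitySet.tCov σ ε d M (β / 2)) * n ^ 2 ≤
            (1 / (M : ℝ) * (n⁻¹ ^ 2 * ∑ i, (z ⬝ᵥ ξ i ω) ^ 2)) * n ^ 2 := by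
              gcongr; linarith
        _ = _ := by field_simp)
    rw [← hW, hTT] at this
    exact this
  -- Passing to the complement by subadditivity avoids showing that `G` is measurable.
  suffices hbad : P.real Gᶜ ≤ β by
    have h1 := measureReal_union_le (μ := P) G Gᶜ
    rw [Set.union_compl_self, probReal_univ] at h1
    linarith
  -- In dimension zero there are no unit vectors, so `σ² ≥ 1` is not available; but then every `ω`
  -- is good.
  rcases Nat.eq_zero_or_pos d with rfl | hd
  · have : Gᶜ = ∅ := by
      rw [Set.compl_empty_iff, Set.eq_univ_iff_forall]
      refine fun ω => hgood ω (by simpa using htm) ?_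
      simp only [hB, Set.mem_ofPred_eq, not_not]
      intro z hz
      rw [Subsingleton.elim z 0, norm_zero] at hz
      exact absurd hz zero_ne_one
    rw [this, measureReal_empty]
    exact hβ0.le
  -- the standardized samples are independent, isotropic and sub-Gaussian
  let c : NNReal := ⟨σ ^ 2, sq_nonneg σ⟩
  let X : Fin M → Ω → EuclideanSpace ℝ (Fin d) := fun i ω => WithLp.toLp 2 (ξ i ω)
  have hmeasE : Measurable fun x : Fin d → ℝ =>
      WithLp.toLp 2 (AmbiguitySet.invSqrt S *ᵥ (x - μ)) := by fun_prop
  have hXind : iIndepFun X P := hindep.comp (fun _ => _) fun _ => hmeasE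
  have hXm : ∀ i, AEMeasurable (X i) P := fun i =>
    hmeasE.comp_aemeasurable (hident i).aemeasurable_fst
  have hinner : ∀ (v : EuclideanSpace ℝ (Fin d)) (i : Fin M) (ω : Ω),
      inner ℝ v (X i ω) = v.ofLp ⬝ᵥ ξ i ω := fun v i ω => by
    rw [EuclideanSpace.inner_eq_star_dotProduct, star_trivial, dotProduct_comm]
  have hidz : ∀ (v : EuclideanSpace ℝ (Fin d)) (i : Fin M),
      IdentDistrib (fun ω => v.ofLp ⬝ᵥ (AmbiguitySet.invSqrt S *ᵥ (w ω - μ)))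
        (fun ω => v.ofLp ⬝ᵥ ξ i ω) P P := fun v i => by
    have hm : Measurable fun x : Fin d → ℝ =>
        v.ofLp ⬝ᵥ (AmbiguitySet.invSqrt S *ᵥ (x - μ)) := by
      unfold dotProduct
      fun_prop
    exact (hident i).symm.comp hm
  have hXsub : ∀ v : EuclideanSpace ℝ (Fin d), ‖v‖ = 1 → ∀ i,
      HasSubgaussianMGF (fun ω => inner ℝ v (X i ω)) c P := fun v hv i => by
    simp_rw [hinner]
    exact (hsub v hv).2.congr_identDistrib (hidz v i)
  have hXiso : ∀ v : EuclideanSpace ℝ (Fin d), ‖v‖ = 1 → ∀ i,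
      ∫ ω, inner ℝ v (X i ω) ^ 2 ∂P = 1 := fun v hv i => by
    simp_rw [hinner]
    have := ((hidz v i).comp (measurable_id.pow_const 2)).integral_eq
    simp only [Function.comp_def, id_eq] at this
    rw [← this, AmbiguitySet.integral_sq_dotProduct_invSqrt hw μ hS hSpos, dotProduct]
    simp_rw [← sq]
    rw [← EuclideanSpace.real_norm_sq_eq, hv, one_pow]
  have hfin : Module.finrank ℝ (EuclideanSpace ℝ (Fin d)) = d := finrank_euclideanSpace_fin
  have : Nontrivial (EuclideanSpace ℝ (Fin d)) := Module.finrank_pos_iff.1 (hfin ▸ hd)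
  have hσ1 : 1 ≤ σ ^ 2 := by
    obtain ⟨v, hv⟩ := exists_norm_eq (EuclideanSpace ℝ (Fin d)) (zero_le_one' ℝ)
    exact AmbiguitySet.one_le_of_integral_sq_eq_one (hXsub v hv ⟨0, hM0⟩) (hXiso v hv ⟨0, hM0⟩)
  have hσ0 : 0 < σ ^ 2 := by linarith
  have hPA : P.real A ≤ β / 2 := by
    have hlog : 0 < Real.log (1 / (β / 2)) := Real.log_pos (by
      rw [one_lt_div (by positivity)]; linarith)
    have h := AmbiguitySet.measureReal_sq_norm_mean_ge_le hM0 (c := c) hσ0 (hfin.symm ▸ hd) hXm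
      hXind hXsub hlog
    rw [hfin, ← Real.log_inv, Real.exp_log (by positivity), one_div, inv_inv] at h
    refine le_of_eq_of_le ?_ h
    congr 1
    ext ω
    have hnorm : ‖(1 / (M : ℝ)) • ∑ i, X i ω‖ ^ 2 = AmbiguitySet.empMean (fun i => ξ i ω) ⬝ᵥ
        AmbiguitySet.empMean (fun i => ξ i ω) := by
      have hmean : (1 / (M : ℝ)) • ∑ i, X i ω =
          WithLp.toLp 2 (AmbiguitySet.empMean fun i => ξ i ω) := by
        simp only [X, AmbiguitySet.empMean, WithLp.toLp_smul, WithLp.toLp_sum]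
      rw [hmean, EuclideanSpace.real_norm_sq_eq, dotProduct]
      simp_rw [sq]
    simp only [hA, Set.mem_ofPred_eq]
    rw [hnorm, AmbiguitySet.tMean, AmbiguitySet.p, one_div]
    rfl
  have hPB : P.real B ≤ β / 2 := by
    obtain ⟨δ, hδ0, hδ, hδε, hlog⟩ := AmbiguitySet.exists_net_radius hε0 hε
    set τ : ℝ := (1 - 2 * δ ^ 2) * AmbiguitySet.tCov σ ε d M (β / 2) / σ ^ 2 with hτ
    have hτs : σ ^ 2 * τ = (1 - 2 * δ ^ 2) * AmbiguitySet.tCov σ ε d M (β / 2) := by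
      have hσ : σ ≠ 0 := pow_ne_zero_iff two_ne_zero |>.1 hσ0.ne'
      rw [hτ]; field_simp
    have hδ1 : 0 ≤ 1 - 2 * δ ^ 2 := by linarith
    have hτ0 : 0 ≤ τ := by positivity
    -- The sample size condition forces `t_Σ < 1`, and `σ² ≥ 1`, so the restriction to small
    -- deviations is harmless.
    have hτ1 : τ ≤ 4 := by
      rw [hτ, div_le_iff₀ hσ0]
      nlinarith [sq_nonneg δ]
    have h := AmbiguitySet.measureReal_secondMoment_le hM0 hXind hXsub hXiso hδ0 hδ hτ0 hτ1 hτs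
    simp_rw [hinner, hfin] at h
    exact h.trans (AmbiguitySet.net_tail_le hε0 hε hβ0 hβ1 hM0 hσ0 hδ0 hδε hlog hτs)
  have hcover : Gᶜ ⊆ A ∪ B := fun ω hω => by
    by_contra hcon
    rw [Set.mem_union, not_or] at hcon
    exact hω (hgood ω (not_le.1 hcon.1).le hcon.2)
  calc P.real Gᶜ ≤ P.real (A ∪ B) := measureReal_mono hcover
    _ ≤ P.real A + P.real B := measureReal_union_le _ _
    _ ≤ β := by linarith
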